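/- Let $\mathcal A$ be a finite alphabet and equip $\mathcal A^{\mathbb Z}$ with the product of the discrete topologies and with the shift $\sigma((x_n)_n)=(x_{n+1})_n$. A substitution is a map $\tau:\mathcal A\to\mathcal A^*$, extended to words by concatenation, such that $|\tau^n(a)|\to\infty$ for every letter $a$. It induces the subshift $X_\tau$ of all $x\in\mathcal A^{\mathbb Z}$ each of whose finite words is a subword of $\tau^n(a)$ for some $n\ge 1$ and $a\in\mathcal A$; the subshifts $(X_\tau,\sigma)$ are called substitutive. A subshift is minimal if it is nonempty and each of its $\sigma$-orbits $\{\sigma^n x;\ n\in\mathbb Z\}$ is dense in it, and $\mathrm{Aut}(X,\sigma)$ denotes the group of homeomorphisms of $X$ commuting with $\sigma$. **Theorem.** For every finite group $G$ there is a minimal substitutive subshift $(X,\sigma)$ such that $\mathrm{Aut}(X,\sigma)$ is isomorphic to $\mathbb Z\oplus G$. Moreover, suppose that $G$ is nontrivial and let $G=\{g_0,g_1,\dots,g_{q-1}\}$ be any enumeration of its $q$ elements (without repetition) with $g_0$ the identity. Then the map on the alphabet $G$ given by $$\tau(g)=(g g_0)(g g_1)\cdots(g g_{q-1})\qquad(g\in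 G)$$ is a substitution of constant length $q$ that is bijective (for $a\ne b$ the words $\tau(a)$ and $\tau(b)$ differ at every coordinate), $(X_\tau,\sigma)$ is minimal, each left translation $L_g((x_n)_{n\in\mathbb Z})=(g x_n)_{n\in\mathbb Z}$ with $g\in G$ preserves $X_\tau$, and the map $(n,g)\mapsto \sigma^n\circ L_g$ is a group isomorphism from $\mathbb Z\oplus G$ onto $\mathrm{Aut}(X_\tau,\sigma)$. In particular, every automorphism of $(X_\tau,\sigma)$ is a power of the shift composed with a left translation $L_g$. -/

import Mathlib

universe u

open Filter
open SymbolicDynamics.FullShift (shift Subshift)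

namespace SubstDyn

/-- A topological dynamical system `(X, T)`, with `T` a homeomorphism of the (nonempty) space `X`,
is minimal if the orbit `{Tⁿ x ; n ∈ ℤ}` of every point is dense. -/
def IsMinimalSystem {X : Type*} [TopologicalSpace X] (T : X ≃ₜ X) : Prop :=
  Nonempty X ∧ ∀ x : X, Dense (Set.range fun n : ℤ => (T ^ n) x)

/-- `Aut(X, T)`: the group (under composition) of homeomorphisms `φ` of `X` with `φ ∘ T = T ∘ φ`. -/
def Aut {X : Type*} [TopologicalSpace X] (T : X ≃ₜ X) : Subgroup (X ≃ₜ X) :=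
  Subgroup.centralizer {T}

theorem mem_Aut {X : Type*} [TopologicalSpace X] (T φ : X ≃ₜ X) :
    φ ∈ Aut T ↔ ⇑φ ∘ ⇑T = ⇑T ∘ ⇑φ := by
  rw [Aut, Subgroup.mem_centralizer_singleton_iff]
  constructor
  · intro h
    funext x
    exact DFunLike.congr_fun h x
  · intro h
    ext x
    exact congrFun h x

section Shift

variable {A : Type*} [TopologicalSpace A]

/-- The shift map `σ` of a two-sided subshift `X`, `(σ x)ₙ = xₙ₊₁`, as a homeomorphism of `X`. -/
def shiftHomeo (X : Subshift A ℤ) : X.carrier ≃ₜ X.carrier where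
  toFun x := ⟨shift 1 x.1, X.mapsTo 1 x.2⟩
  invFun x := ⟨shift (-1) x.1, X.mapsTo (-1) x.2⟩
  left_inv x := by
    apply Subtype.ext
    funext n
    simp [shift]
  right_inv x := by
    apply Subtype.ext
    funext n
    simp [shift]
  continuous_toFun := by
    apply Continuous.subtype_mk
    exact (SymbolicDynamics.FullShift.continuous_shift 1).comp continuous_subtype_val
  continuous_invFun := by
    apply Continuous.subtype_mk
    exact (SymbolicDynamics.FullShift.continuous_shift (-1)).comp continuous_subtype_val

end Shift

section Substitution

variable {A : Type*}

/-- The word `τⁿ(a)`, where a map `τ` from letters to words acts on words by concatenation. -/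
def iterWord (τ : A → List A) (n : ℕ) (a : A) : List A :=
  (fun w : List A => w.flatMap τ)^[n] [a]

/-- A substitution: the length of `τⁿ(a)` tends to infinity for every letter `a`. -/
def IsSubstitution (τ : A → List A) : Prop :=
  ∀ a : A, Tendsto (fun n : ℕ => (iterWord τ n a).length) atTop atTop

/-- `τ` has constant length `ℓ > 0`. -/
def HasConstantLength (τ : A → List A) (ℓ : ℕ) : Prop :=
  0 < ℓ ∧ ∀ a : A, (τ a).length = ℓ

/-- A constant-length `τ` is bijective if distinct letters have images that differ at every
coordinate. -/
def IsBijectiveSubst (τ : A → List A) (ℓ : ℕ) : Prop :=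
  HasConstantLength τ ℓ ∧ ∀ a b : A, a ≠ b → ∀ i : ℕ, i < ℓ → (τ a)[i]? ≠ (τ b)[i]?

/-- The finite word `x_m … x_{m+ℓ-1}` of a two-sided sequence. -/
def wordAt (x : ℤ → A) (m : ℤ) (ℓ : ℕ) : List A :=
  List.ofFn fun i : Fin ℓ => x (m + (i : ℕ))

/-- The set `X_τ` of two-sided sequences each of whose finite words is a subword (factor) of
`τⁿ(a)` for some `n ≥ 1` and some letter `a`. -/
def substSet (τ : A → List A) : Set (ℤ → A) :=
  {x | ∀ (m : ℤ) (ℓ : ℕ), ∃ n : ℕ, 1 ≤ n ∧ ∃ a : A, wordAt x m ℓ <:+: iterWord τ n a}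

theorem shift_mem_substSet (τ : A → List A) (k : ℤ) :
    Set.MapsTo (shift k) (substSet τ) (substSet τ) := by
  intro x hx m ℓ
  have h : wordAt (shift k x) m ℓ = wordAt x (k + m) ℓ := by
    simp [wordAt, shift, add_assoc]
  rw [h]
  exact hx (k + m) ℓ

variable [TopologicalSpace A] [DiscreteTopology A]

theorem isClosed_substSet (τ : A → List A) : IsClosed (substSet τ) := by
  have h : substSet τ = ⋂ (m : ℤ) (ℓ : ℕ),
      (fun (x : ℤ → A) (i : Fin ℓ) => x (m + (i : ℕ))) ⁻¹'
        {w : Fin ℓ → A | ∃ n : ℕ, 1 ≤ n ∧ ∃ a : A, List.ofFn w <:+: iterWord τ n a} := by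
    ext x
    simp [substSet, wordAt]
  rw [h]
  refine isClosed_iInter fun m => isClosed_iInter fun ℓ => ?_
  exact (isClosed_discrete _).preimage (by fun_prop)

/-- The subshift `(X_τ, σ)` induced by `τ`. -/
def substSubshift (τ : A → List A) : Subshift A ℤ where
  carrier := substSet τ
  isClosed := isClosed_substSet τ
  mapsTo := shift_mem_substSet τ

/-- A subshift is substitutive if it is induced by some substitution on its alphabet. -/
def IsSubstitutive (X : Subshift A ℤ) : Prop :=
  ∃ τ : A → List A, IsSubstitution τ ∧ X = substSubshift τ

end Substitution

section Group

variable {G : Type*} [Group G]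

/-- The left translation `L_g` on two-sided sequences over `G`: `L_g((xₙ)ₙ) = (g xₙ)ₙ`. -/
def leftTranslate (g : G) (x : ℤ → G) : ℤ → G := fun n => g * x n

/-- The substitution `g ↦ (g g₀)(g g₁)⋯(g g_{q-1})` on the alphabet `G`, for an enumeration
`g₀, …, g_{q-1}` of `G`. -/
def groupSubst {q : ℕ} (e : Fin q ≃ G) : G → List G :=
  fun g => List.ofFn fun i : Fin q => g * e i

end Group

end SubstDyn

/-!
Let a group `K` act transitively on the alphabet `A`, and let `τ` send `a` to the word of all
`k • a`, `k ∈ K`, in some order starting with `1 • a`. A point of `X_τ` is what one sees of the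
words `τⁿ(a)` around a position going to infinity along an ultrafilter. It is cut into words
`τ(yₙ)` with `y` again in `X_τ`, and the cutting positions are unique. An automorphism is a sliding
block code; passing to the desubstituted points divides the length of its window by `q = |K|`, so
after finitely many steps it becomes a shift followed by a permutation of the letters. Comparing the
columns of `τ`, this permutation must commute with `K`. Hence `Aut(X_τ, σ)` is `ℤ` times the
centralizer of `K` in the permutations of `A`. For `K` acting on `A = G` by right translations,
`τ` is the substitution of the theorem and the centralizer is `G`, acting by left translations.
-/

namespace SubstDyn

open Equiv (Perm)

section Dynamics

variable {X : Type*} [TopologicalSpace X] {T φ ψ : X ≃ₜ X}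

theorem self_mem_Aut (T : X ≃ₜ X) : T ∈ Aut T :=
  Subgroup.mem_centralizer_singleton_iff.2 rfl

theorem apply_zpow_of_mem_Aut (hφ : φ ∈ Aut T) (n : ℤ) (x : X) :
    φ ((T ^ n) x) = (T ^ n) (φ x) :=
  have hcomm : Commute φ T := Subgroup.mem_centralizer_singleton_iff.1 hφ
  DFunLike.congr_fun (hcomm.zpow_right n).eq x

theorem IsMinimalSystem.eq_of_apply_eq [T2Space X] (hT : IsMinimalSystem T) (hφ : φ ∈ Aut T)
    (hψ : ψ ∈ Aut T) {x : X} (h : φ x = ψ x) : φ = ψ := by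
  refine DFunLike.coe_injective (Continuous.ext_on (hT.2 x) φ.continuous ψ.continuous ?_)
  rintro _ ⟨n, rfl⟩
  simp only [apply_zpow_of_mem_Aut hφ, apply_zpow_of_mem_Aut hψ, h]

end Dynamics

section SlidingBlockCodes

theorem exists_finset_forall_eq_of_continuous {ι B : Type*} {A : ι → Type*}
    [∀ i, TopologicalSpace (A i)] [∀ i, T2Space (A i)] [TopologicalSpace B] [DiscreteTopology B]
    {X : Set (∀ i, A i)} (hX : IsCompact X) {f : X → B} (hf : Continuous f) :
    ∃ I : Finset ι, ∀ x y : X, (∀ i ∈ I, x.1 i = y.1 i) → f x = f y := by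
  have : CompactSpace X := isCompact_iff_compactSpace.1 hX
  have hne : IsClosed {p : X × X | f p.1 ≠ f p.2} :=
    (isClosed_discrete {b : B × B | b.1 ≠ b.2}).preimage (by fun_prop : Continuous (Prod.map f f))
  obtain ⟨I, hI⟩ := hne.isCompact.elim_finite_subfamily_closed
    (fun i => {p : X × X | p.1.1 i = p.2.1 i})
    (fun i => isClosed_eq
      ((continuous_apply i).comp (continuous_subtype_val.comp continuous_fst))
      ((continuous_apply i).comp (continuous_subtype_val.comp continuous_snd))) <|
    Set.eq_empty_of_forall_notMem fun p ⟨hp, hp'⟩ =>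
      hp (congrArg f (Subtype.ext (funext fun i => Set.mem_iInter.1 hp' i)))
  refine ⟨I, fun x y hxy => by_contra fun h => ?_⟩
  exact Set.notMem_empty (x, y) (hI ▸ ⟨h, Set.mem_iInter₂.2 hxy⟩)

/-- The sequence `x'` is read off `x` by a sliding block code with window `[a, a + w]`: the letter
`x'ₙ` depends only on the word `x_{n+a} … x_{n+a+w}`. Only the windows that occur in `x` matter. -/
def IsBlockImage {A : Type*} (x x' : ℤ → A) (a : ℤ) (w : ℕ) : Prop :=
  ∀ n n' : ℤ, (∀ j ≤ w, x (n + a + (j : ℕ)) = x (n' + a + (j : ℕ))) → x' n = x' n'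

end SlidingBlockCodes

section Subshift

variable {A : Type*} [TopologicalSpace A]

theorem coe_shiftHomeo_zpow (X : Subshift A ℤ) (n : ℤ) (x : X.carrier) :
    ((shiftHomeo X ^ n) x : ℤ → A) = shift n x := by
  induction n using Int.induction_on generalizing x with
  | zero => simp
  | succ n ih =>
    rw [zpow_add_one, Homeomorph.mul_apply, ih, add_comm,
      SymbolicDynamics.FullShift.shift_add]
    rfl
  | pred n ih =>
    rw [zpow_sub_one, Homeomorph.mul_apply, ih, sub_eq_neg_add,
      SymbolicDynamics.FullShift.shift_add]
    rfl

theorem isMinimalSystem_shiftHomeo {X : Subshift A ℤ} (hne : X.carrier.Nonempty)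
    (h : ∀ x ∈ X.carrier, ∀ y ∈ X.carrier, ∀ I : Finset ℤ, ∃ m : ℤ, ∀ j ∈ I, x (m + j) = y j) :
    IsMinimalSystem (shiftHomeo X) := by
  refine ⟨hne.to_subtype, fun x => dense_iff_inter_open.2 ?_⟩
  rintro _ ⟨V, hV, rfl⟩ ⟨y, hy⟩
  obtain ⟨I, u, hu, hIV⟩ := isOpen_pi_iff.1 hV y hy
  obtain ⟨m, hm⟩ := h x x.2 y y.2 I
  refine ⟨_, hIV fun j hj => ?_, m, rfl⟩
  rw [coe_shiftHomeo_zpow, SymbolicDynamics.FullShift.shift_apply, hm j hj]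
  exact (hu j hj).2

theorem exists_isBlockImage_of_mem_Aut [Finite A] [DiscreteTopology A] {X : Subshift A ℤ}
    {φ : X.carrier ≃ₜ X.carrier} (hφ : φ ∈ Aut (shiftHomeo X)) (x : X.carrier) :
    ∃ (a : ℤ) (w : ℕ), IsBlockImage x.1 (φ x).1 a w := by
  obtain ⟨I, hI⟩ := exists_finset_forall_eq_of_continuous X.isClosed.isCompact
    ((continuous_apply 0).comp (continuous_subtype_val.comp φ.continuous))
  have hval (n : ℤ) : (φ x).1 n = (φ ((shiftHomeo X ^ n) x)).1 0 := by
    rw [apply_zpow_of_mem_Aut hφ, coe_shiftHomeo_zpow]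
    simp [shift]
  set R := I.sup Int.natAbs
  refine ⟨-R, 2 * R, fun n n' h => ?_⟩
  rw [hval, hval]
  refine hI _ _ fun j hj => ?_
  have hjR : j.natAbs ≤ R := Finset.le_sup hj
  have hwindow := h (j + R).toNat (by lia)
  rw [Int.toNat_of_nonneg (by lia)] at hwindow
  simpa [coe_shiftHomeo_zpow, shift, add_assoc] using hwindow

section LetterMaps

variable [DiscreteTopology A] (X : Subshift A ℤ) (S : Subgroup (Perm A))
  (hS : ∀ F ∈ S, ∀ x ∈ X.carrier, F ∘ x ∈ X.carrier)

/-- A group of permutations of the alphabet that preserves a subshift acts on it letter by letter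
through automorphisms. -/
def letterHom : S →* Aut (shiftHomeo X) where
  toFun F :=
    ⟨{ toFun := fun x => ⟨F.1 ∘ x.1, hS F F.2 x x.2⟩
       invFun := fun x => ⟨F⁻¹.1 ∘ x.1, hS _ F⁻¹.2 x x.2⟩
       left_inv := fun x => by ext; simp
       right_inv := fun x => by ext; simp
       continuous_toFun := ((Pi.continuous_postcomp continuous_of_discreteTopology).comp
         continuous_subtype_val).subtype_mk _
       continuous_invFun := ((Pi.continuous_postcomp continuous_of_discreteTopology).comp
         continuous_subtype_val).subtype_mk _ }, (mem_Aut _ _).2 rfl⟩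
  map_one' := rfl
  map_mul' _ _ := rfl

/-- The homomorphism `(n, F) ↦ σⁿ ∘ F`, where the permutation `F` is applied letter by letter. -/
def shiftLetterHom : Multiplicative ℤ × S →* Aut (shiftHomeo X) :=
  (zpowersHom _ ⟨shiftHomeo X, self_mem_Aut _⟩).noncommCoprod (letterHom X S hS) fun n F =>
    Commute.zpow_left (Subtype.ext (Subgroup.mem_centralizer_singleton_iff.1
      (letterHom X S hS F).2).symm) n.toAdd

theorem coe_shiftLetterHom_apply (n : ℤ) (F : S) (x : X.carrier) :
    ((shiftLetterHom X S hS (.ofAdd n, F)).1 x : ℤ → A) = shift n (F.1 ∘ x.1) :=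
  coe_shiftHomeo_zpow X n _

end LetterMaps

end Subshift

section EquivariantPerm

/-- The group of permutations of `A` that commute with the action of `K`. -/
def equivariantPerm (K A : Type*) [Group K] [MulAction K A] : Subgroup (Perm A) :=
  Subgroup.centralizer (Set.range (MulAction.toPerm : K → Perm A))

theorem mem_equivariantPerm {K A : Type*} [Group K] [MulAction K A] {F : Perm A} :
    F ∈ equivariantPerm K A ↔ ∀ (k : K) (a : A), F (k • a) = k • F a := by
  simp only [equivariantPerm, Subgroup.mem_centralizer_iff, Set.forall_mem_range, Equiv.ext_iff,
    Perm.mul_apply, MulAction.toPerm_apply, eq_comm]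

/-- A group `G` acts on itself by the left translations `leftMulEquiv G g : h ↦ g * h`; they are the
permutations that commute with all right translations. -/
def leftMulEquiv (G : Type*) [Group G] : G ≃* equivariantPerm Gᵐᵒᵖ G where
  toFun g := ⟨MulAction.toPerm g, mem_equivariantPerm.2 fun k a => smul_comm g k a⟩
  invFun F := F.1 1
  left_inv g := mul_one g
  right_inv F := by
    ext a
    simpa using (mem_equivariantPerm.1 F.2 (.op a) 1).symm
  map_mul' g h := Subtype.ext (map_mul (MulAction.toPermHom G G) g h)

theorem equivariantPerm_perm_eq_bot {A : Type*} (hA : 3 ≤ Cardinal.mk A) :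
    equivariantPerm (Perm A) A = ⊥ := by
  classical
  refine (Subgroup.eq_bot_iff_forall _).2 fun F hF => Equiv.ext fun b => by_contra fun hb => ?_
  obtain ⟨d, hdb, hdF⟩ := Cardinal.exists_ne_ne_of_three_le hA b (F b)
  rw [Perm.one_apply] at hb
  have h := mem_equivariantPerm.1 hF (Equiv.swap (F b) d) b
  rw [Perm.smul_def, Perm.smul_def, Equiv.swap_apply_left,
    Equiv.swap_apply_of_ne_of_ne (Ne.symm hb) hdb.symm] at h
  exact hdF h.symm

end EquivariantPerm

section ColumnSubst

variable {K A : Type*} [Group K] [MulAction K A] {q : ℕ}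

/-- The substitution `a ↦ (c₀ • a)(c₁ • a)⋯(c_{q-1} • a)` of constant length `q`. -/
def columnSubst (A : Type*) [MulAction K A] (c : Fin q → K) (a : A) : List A :=
  List.ofFn fun i => c i • a

variable [NeZero q] {c : Fin q → K}

/-- The product `c_{d₀} c_{d₁} ⋯` over the base-`q` digits `d₀, d₁, …` of `n`, the least
significant one first. If `c₀ = 1`, then letter `n` of every long enough word `τᵏ(a)` is
`digitProd c n • a`. -/
def digitProd (c : Fin q → K) (n : ℕ) : K :=
  ((Nat.digits q n).map fun d => c (Fin.ofNat q d)).prod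

theorem digitProd_zero (c : Fin q → K) : digitProd c 0 = 1 := by
  simp [digitProd]

theorem digitProd_mul_add (hc : c 0 = 1) (hq : 1 < q) (n : ℕ) (i : Fin q) :
    digitProd c (q * n + i) = c i * digitProd c n := by
  by_cases h : (i : ℕ) ≠ 0 ∨ n ≠ 0
  · rw [digitProd, add_comm, Nat.digits_add q hq i n i.2 h]
    simp [digitProd]
  · obtain ⟨hi, rfl⟩ : (i : ℕ) = 0 ∧ n = 0 := by simpa using h
    obtain rfl : i = 0 := Fin.ext hi
    simp [digitProd_zero, hc]

theorem flatMap_range_ofFn {B : Type*} (f : ℕ → B) (q m : ℕ) :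
    ((List.range m).flatMap fun n => List.ofFn fun i : Fin q => f (q * n + i)) =
      (List.range (q * m)).map f := by
  induction m with
  | zero => simp
  | succ m ih =>
    rw [List.range_succ, List.flatMap_append, ih, mul_add, mul_one, List.range_add]
    simp [List.ofFn_eq_map, ← List.map_coe_finRange_eq_range]

theorem iterWord_columnSubst (hc : c 0 = 1) (hq : 1 < q) (n : ℕ) (a : A) :
    iterWord (columnSubst A c) n a = (List.range (q ^ n)).map fun m => digitProd c m • a := by
  induction n with
  | zero => simp [iterWord, digitProd_zero]
  | succ n ih =>
    rw [iterWord] at ih ⊢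
    rw [Function.iterate_succ_apply', ih, pow_succ', ← flatMap_range_ofFn, List.flatMap_map]
    simp only [columnSubst, digitProd_mul_add hc hq, mul_smul]

theorem isSubstitution_columnSubst (hc : c 0 = 1) (hq : 1 < q) :
    IsSubstitution (columnSubst A c) := fun a => by
  simpa only [iterWord_columnSubst hc hq, List.length_map, List.length_range] using
    tendsto_pow_atTop_atTop_of_one_lt hq

theorem wordAt_infix_map_range {B : Type*} (x : ℤ → B) (f : ℕ → B) (m : ℤ) (l M : ℕ) :
    wordAt x m l <:+: (List.range M).map f ↔
      ∃ k, k + l ≤ M ∧ ∀ i < l, x (m + i) = f (k + i) := by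
  rw [List.infix_iff_getElem?]
  constructor
  · rintro ⟨k, hk, h⟩
    simp only [wordAt, List.length_ofFn, List.length_map, List.length_range] at hk h
    refine ⟨k, by lia, fun i hi => ?_⟩
    have hget := h i hi
    rw [List.getElem?_map, List.getElem?_range (by lia)] at hget
    simpa [add_comm, eq_comm] using hget
  · rintro ⟨k, hk, h⟩
    refine ⟨k, by simp [wordAt]; lia, fun i hi => ?_⟩
    simp only [wordAt, List.length_ofFn] at hi
    rw [List.getElem?_map, List.getElem?_range (by lia)]
    simp [wordAt, h i hi, add_comm]

theorem mem_substSet_columnSubst (hc : c 0 = 1) (hq : 1 < q) {x : ℤ → A} :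
    x ∈ substSet (columnSubst A c) ↔
      ∀ (m : ℤ) (l : ℕ), ∃ (a : A) (k : ℕ), ∀ i < l, x (m + i) = digitProd c (k + i) • a := by
  simp only [substSet, Set.mem_ofPred_eq, iterWord_columnSubst hc hq, wordAt_infix_map_range]
  refine forall₂_congr fun m l => ⟨?_, ?_⟩
  · rintro ⟨n, -, a, k, -, h⟩
    exact ⟨a, k, h⟩
  · rintro ⟨a, k, h⟩
    have hlt : k + l < q ^ (k + l) := Nat.lt_pow_self hq
    exact ⟨k + l + 1, by lia, a, k, hlt.le.trans (Nat.pow_le_pow_right hq.le (Nat.le_succ _)), h⟩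

theorem mem_substSet_iff_exists_ultrafilter (hc : c 0 = 1) (hq : 1 < q) {x : ℤ → A} :
    x ∈ substSet (columnSubst A c) ↔ ∃ U : Ultrafilter (ℕ × A),
      Tendsto Prod.fst (U : Filter (ℕ × A)) atTop ∧
      ∀ j : ℤ, ∀ᶠ s : ℕ × A in U, x j = digitProd c (s.1 + j).toNat • s.2 := by
  rw [mem_substSet_columnSubst hc hq]
  constructor
  · intro h
    choose a k hk using fun N : ℕ => h (-N) (2 * N + 1)
    refine ⟨(hyperfilter ℕ).map fun N => (k N + N, a N), ?_, fun j => ?_⟩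
    · exact (tendsto_atTop_mono (fun N => Nat.le_add_left N (k N)) tendsto_id).mono_left
        Nat.hyperfilter_le_atTop
    · have hlarge : ∀ᶠ N in hyperfilter ℕ, j.natAbs ≤ N :=
        Nat.hyperfilter_le_atTop (eventually_ge_atTop _)
      refine eventually_map.2 (hlarge.mono fun N hN => ?_)
      convert hk N (j + N).toNat (by lia) using 3 <;> lia
  · rintro ⟨U, hU, h⟩ m l
    have hall : ∀ᶠ s : ℕ × A in U, ∀ i ∈ Finset.range l,
        x (m + i) = digitProd c (s.1 + (m + i)).toNat • s.2 :=
      (eventually_all_finset _).2 fun i _ => h (m + i)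
    obtain ⟨s, hs, hms⟩ := (hall.and (hU.eventually_ge_atTop m.natAbs)).exists
    refine ⟨s.2, (s.1 + m).toNat, fun i hi => ?_⟩
    rw [hs i (Finset.mem_range.2 hi)]
    congr 2
    lia

theorem comp_mem_substSet (hc : c 0 = 1) (hq : 1 < q) {F : A → A}
    (hF : ∀ (k : K) (a : A), F (k • a) = k • F a) {x : ℤ → A}
    (hx : x ∈ substSet (columnSubst A c)) : F ∘ x ∈ substSet (columnSubst A c) := by
  rw [mem_substSet_columnSubst hc hq] at hx ⊢
  intro m l
  obtain ⟨a, k, h⟩ := hx m l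
  exact ⟨F a, k, fun i hi => by rw [Function.comp_apply, h i hi, hF]⟩

theorem nonempty_substSet [Finite A] [Nonempty A] (hc : c 0 = 1) (hq : 1 < q) :
    (substSet (columnSubst A c)).Nonempty := by
  obtain ⟨a⟩ := ‹Nonempty A›
  have hlim (j : ℤ) : ∃ b : A, ∀ᶠ n : ℕ in hyperfilter ℕ, b = digitProd c (n + j).toNat • a :=
    Ultrafilter.eventually_exists_iff.1 (Eventually.of_forall fun n => ⟨_, rfl⟩)
  choose x hx using hlim
  exact ⟨x, (mem_substSet_iff_exists_ultrafilter hc hq).2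
    ⟨(hyperfilter ℕ).map (·, a), Nat.hyperfilter_le_atTop, hx⟩⟩

/-- `x` is the concatenation of the words `τ(yₙ)`, the word `τ(y₀)` starting at coordinate `r`. -/
def IsDesubst (c : Fin q → K) (x : ℤ → A) (r : ℤ) (y : ℤ → A) : Prop :=
  ∀ (n : ℤ) (i : Fin q), x (q * n + r + (i : ℕ)) = c i • y n

theorem IsDesubst.apply_start (hc : c 0 = 1) {x y : ℤ → A} {r : ℤ} (h : IsDesubst c x r y)
    (n : ℤ) : x (q * n + r) = y n := by
  simpa [hc] using h n 0

theorem exists_eq_mul_add (q : ℕ) [NeZero q] (m : ℤ) : ∃ (t : ℤ) (i : Fin q), m = q * t + (i : ℕ) :=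
  ⟨_, _, by rw [mul_comm]; exact ((Int.divModEquiv q).symm_apply_apply m).symm⟩

/-- The phase `r` is the residue of `-p` modulo `q` for almost all positions `p` around which `x`
is seen. -/
theorem exists_isDesubst (hc : c 0 = 1) (hq : 1 < q) {x : ℤ → A}
    (hx : x ∈ substSet (columnSubst A c)) :
    ∃ (r : ℤ) (y : ℤ → A), y ∈ substSet (columnSubst A c) ∧ IsDesubst c x r y := by
  obtain ⟨U, hU, hxU⟩ := (mem_substSet_iff_exists_ultrafilter hc hq).1 hx
  obtain ⟨r, hr⟩ : ∃ r : Fin q, ∀ᶠ s : ℕ × A in U, q ∣ s.1 + r :=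
    Ultrafilter.eventually_exists_iff.1 (Eventually.of_forall fun s => by
      obtain ⟨t, r, hr⟩ := exists_eq_mul_add q (-s.1)
      exact ⟨r, Int.natCast_dvd_natCast.1 ⟨-t, by push_cast; linarith⟩⟩)
  let d (s : ℕ × A) : ℕ := (s.1 + r) / q
  have hd : Tendsto d U atTop :=
    (Nat.tendsto_div_const_atTop (NeZero.ne q)).comp
      (tendsto_atTop_mono (fun s => Nat.le_add_right s.1 r) hU)
  have hletter (n : ℤ) (i : Fin q) : ∀ᶠ s : ℕ × A in U,
      x (q * n + r + (i : ℕ)) = c i • digitProd c (d s + n).toNat • s.2 := by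
    filter_upwards [hxU (q * n + r + (i : ℕ)), hr, hd.eventually_ge_atTop n.natAbs]
      with s hs hdvd hlarge
    have hsd : (s.1 : ℤ) + r = q * d s := mod_cast (Nat.mul_div_cancel' hdvd).symm
    obtain ⟨N, hN⟩ : ∃ N : ℕ, (d s + n : ℤ) = N := Int.eq_ofNat_of_zero_le (by omega)
    have hpos : (s.1 : ℤ) + (q * n + r + (i : ℕ)) = (q * N + i : ℕ) := by
      push_cast
      linear_combination hsd + q * hN
    rw [hs, hpos, hN, Int.toNat_natCast, Int.toNat_natCast, digitProd_mul_add hc hq, mul_smul]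
  have hstart (n : ℤ) : ∀ᶠ s : ℕ × A in U, x (q * n + r) = digitProd c (d s + n).toNat • s.2 := by
    simpa [hc] using hletter n 0
  refine ⟨(r : ℕ), fun n => x (q * n + r), ?_, fun n i => ?_⟩
  · exact (mem_substSet_iff_exists_ultrafilter hc hq).2 ⟨U.map fun s => (d s, s.2), hd, hstart⟩
  · obtain ⟨s, hs, hs'⟩ := ((hletter n i).and (hstart n)).exists
    exact hs.trans (congrArg (c i • ·) hs'.symm)

/-- Reading the column of `x'` whose windows start at the beginnings of the words `τ(yₙ)` is what
makes the window length shrink all the way to `0`. -/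
theorem IsDesubst.exists_isBlockImage {x x' y y' : ℤ → A} {r r' a : ℤ} {w : ℕ}
    (hy : IsDesubst c x r y) (hy' : IsDesubst c x' r' y') (h : IsBlockImage x x' a w) :
    ∃ b : ℤ, IsBlockImage y y' b (w / q) := by
  obtain ⟨t, i, hi⟩ := exists_eq_mul_add q (r - r' - a)
  have hwindow (n : ℤ) (j : ℕ) : x (q * n + r' + (i : ℕ) + a + j) =
      c (Fin.ofNat q j) • y (n + -t + (j / q : ℕ)) := by
    have hj : (j : ℤ) = q * (j / q : ℕ) + (j % q : ℕ) := mod_cast (Nat.div_add_mod j q).symm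
    rw [← hy, Fin.val_ofNat]
    congr 1
    linarith
  refine ⟨-t, fun n n' hn => smul_left_cancel (c i) ?_⟩
  rw [← hy', ← hy']
  refine h _ _ fun j hj => ?_
  rw [hwindow, hwindow, hn _ (Nat.div_le_div_right hj)]

section Transitive

variable [MulAction.IsPretransitive K A]

theorem surjective_of_mem_substSet (hc : c 0 = 1) (hq : 1 < q) (hsurj : c.Surjective)
    {x : ℤ → A} (hx : x ∈ substSet (columnSubst A c)) : x.Surjective := fun a => by
  obtain ⟨r, y, -, hy⟩ := exists_isDesubst hc hq hx
  obtain ⟨k, hk⟩ := MulAction.exists_smul_eq K (y 0) a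
  obtain ⟨i, rfl⟩ := hsurj k
  exact ⟨_, (hy 0 i).trans hk⟩

theorem exists_occurrence (hc : c 0 = 1) (hq : 1 < q) (hsurj : c.Surjective) (n : ℕ) (a : A)
    {x : ℤ → A} (hx : x ∈ substSet (columnSubst A c)) :
    ∃ m : ℤ, ∀ t < q ^ n, x (m + t) = digitProd c t • a := by
  induction n generalizing x with
  | zero =>
    obtain ⟨m, rfl⟩ := surjective_of_mem_substSet hc hq hsurj hx a
    refine ⟨m, fun t ht => ?_⟩
    obtain rfl : t = 0 := by simpa using ht
    simp [digitProd_zero]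
  | succ n ih =>
    obtain ⟨r, y, hyX, hy⟩ := exists_isDesubst hc hq hx
    obtain ⟨m, hm⟩ := ih hyX
    refine ⟨q * m + r, fun t ht => ?_⟩
    obtain ⟨⟨u, i⟩, rfl⟩ := (Nat.divModEquiv q).symm.surjective t
    change u * q + i < _ at ht
    change x (_ + (u * q + i : ℕ)) = digitProd c (u * q + i) • a
    have hu : u < q ^ n := by
      rw [pow_succ] at ht
      exact lt_of_mul_lt_mul_right (by lia) (Nat.zero_le q)
    rw [mul_comm u q, digitProd_mul_add hc hq, mul_smul, ← hm u hu, ← hy]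
    congr 1
    push_cast
    ring

theorem exists_shift_agree (hc : c 0 = 1) (hq : 1 < q) (hsurj : c.Surjective) {x y : ℤ → A}
    (hx : x ∈ substSet (columnSubst A c)) (hy : y ∈ substSet (columnSubst A c)) (I : Finset ℤ) :
    ∃ m : ℤ, ∀ j ∈ I, x (m + j) = y j := by
  obtain ⟨U, hU, hyU⟩ := (mem_substSet_iff_exists_ultrafilter hc hq).1 hy
  have hall : ∀ᶠ s : ℕ × A in U,
      ∀ j ∈ I, j.natAbs ≤ s.1 ∧ y j = digitProd c (s.1 + j).toNat • s.2 :=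
    (eventually_all_finset I).2 fun j _ => (hU.eventually_ge_atTop j.natAbs).and (hyU j)
  obtain ⟨⟨p, a⟩, hp⟩ := hall.exists
  obtain ⟨m, hm⟩ := exists_occurrence hc hq hsurj (2 * p) a hx
  refine ⟨m + p, fun j hj => ?_⟩
  obtain ⟨hjp, hyj⟩ := hp j hj
  have hlt : 2 * p < q ^ (2 * p) := Nat.lt_pow_self hq
  rw [hyj, ← hm _ (by lia), Int.toNat_of_nonneg (by lia), add_assoc]

theorem isMinimalSystem_columnSubst [Finite A] [Nonempty A] [TopologicalSpace A]
    [DiscreteTopology A] (hc : c 0 = 1) (hq : 1 < q) (hsurj : c.Surjective) :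
    IsMinimalSystem (shiftHomeo (substSubshift (columnSubst A c))) :=
  isMinimalSystem_shiftHomeo (nonempty_substSet hc hq) fun _ hx _ hy I =>
    exists_shift_agree hc hq hsurj hx hy I

/-- If each letter of `y` determined the next one, then the first two columns would show that the
next letter is `c₁ • yₙ`. As `c₁ ^ q = 1`, the sequence would have period `q`, and reading it along
`qℤ + r` would give a constant point of `X_τ`. -/
theorem exists_eq_and_succ_ne [Nontrivial A] (hc : c 0 = 1) (hq : 1 < q) (hbij : c.Bijective)
    {y : ℤ → A} (hy : y ∈ substSet (columnSubst A c)) :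
    ∃ m n : ℤ, y m = y n ∧ y (m + 1) ≠ y (n + 1) := by
  by_contra! hdet
  obtain ⟨r, z, hzX, hz⟩ := exists_isDesubst hc hq hy
  have hzsurj := surjective_of_mem_substSet hc hq hbij.surjective hzX
  let k : K := c ⟨1, hq⟩
  have hsucc (n : ℤ) : y (n + 1) = k • y n := by
    obtain ⟨m, hm⟩ := hzsurj (y n)
    rw [← hm, ← hz m ⟨1, hq⟩]
    exact (hdet _ _ ((hz.apply_start hc m).trans hm)).symm
  have hpow (m : ℕ) (n : ℤ) : y (n + m) = k ^ m • y n := by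
    induction m with
    | zero => simp
    | succ m ih => rw [Nat.cast_succ, ← add_assoc, hsucc, ih, pow_succ', mul_smul]
  have hper : Function.Periodic y q := fun n => by
    have hcard : Nat.card K = q := Nat.card_eq_of_equiv_fin (Equiv.ofBijective c hbij).symm
    rw [hpow, ← hcard, pow_card_eq_one', one_smul]
  have hconst (n : ℤ) : z n = y r := by
    rw [← hz.apply_start hc, add_comm, mul_comm]
    exact hper.int_mul n r
  obtain ⟨a, b, hab⟩ := exists_pair_ne A
  obtain ⟨m, rfl⟩ := hzsurj a
  obtain ⟨n, rfl⟩ := hzsurj b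
  exact hab ((hconst m).trans (hconst n).symm)

/-- An offset of the two phases would let each letter of `y` determine the next one: the word
`τ(y'ₙ)` then meets both `τ(yₜ)` and `τ(yₜ₊₁)`. -/
theorem IsDesubst.exists_phase_eq [Nontrivial A] (hc : c 0 = 1) (hq : 1 < q) (hbij : c.Bijective)
    {x x' y y' : ℤ → A} {r r' s : ℤ} (hyX : y ∈ substSet (columnSubst A c))
    (hy : IsDesubst c x r y) (hy' : IsDesubst c x' r' y') {F : A → A} (hF : F.Injective)
    (h : ∀ m, x' m = F (x (m + s))) : ∃ t : ℤ, r' + s = q * t + r := by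
  obtain ⟨t, i, hi⟩ := exists_eq_mul_add q (r' + s - r)
  obtain rfl | hi0 := eq_or_ne i 0
  · exact ⟨t, by simpa [sub_eq_iff_eq_add] using hi⟩
  obtain ⟨m, n, hmn, hne⟩ := exists_eq_and_succ_ne hc hq hbij hyX
  have hi_pos : 0 < (i : ℕ) := Nat.pos_of_ne_zero fun h => hi0 (Fin.ext (by simpa using h))
  let i' : Fin q := ⟨q - i, Nat.sub_lt (NeZero.pos q) hi_pos⟩
  have hleft (n : ℤ) : y' (n - t) = F (c i • y n) := by
    rw [← hy'.apply_start hc, h, ← hy]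
    congr 2
    linarith
  have hright (n : ℤ) : c i' • y' (n - t) = F (y (n + 1)) := by
    rw [← hy', h, ← hy.apply_start hc]
    congr 2
    simp only [i', Nat.cast_sub i.2.le]
    linarith
  refine absurd (hF ?_) hne
  rw [← hright, ← hright, hleft, hleft, hmn]

theorem IsDesubst.exists_column_intertwining [Nontrivial A] (hc : c 0 = 1) (hq : 1 < q)
    (hbij : c.Bijective) {x x' y y' : ℤ → A} {r r' s : ℤ} (hyX : y ∈ substSet (columnSubst A c))
    (hy : IsDesubst c x r y) (hy' : IsDesubst c x' r' y') {F : A → A} (hF : F.Injective)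
    (h : ∀ m, x' m = F (x (m + s))) :
    ∃ t : ℤ, r' + s = q * t + r ∧ ∀ n i, c i • y' n = F (c i • y (n + t)) := by
  obtain ⟨t, ht⟩ := hy.exists_phase_eq hc hq hbij hyX hy' hF h
  refine ⟨t, ht, fun n i => ?_⟩
  rw [← hy', h, ← hy]
  congr 2
  linarith

theorem eq_zero_of_forall_eq_apply_add [Nontrivial A] (hc : c 0 = 1) (hq : 1 < q)
    (hbij : c.Bijective) {x : ℤ → A} (hx : x ∈ substSet (columnSubst A c)) {F : A → A}
    (hF : F.Injective) {s : ℤ} (h : ∀ m, x m = F (x (m + s))) : s = 0 := by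
  induction hs : s.natAbs using Nat.strong_induction_on generalizing x s with
  | _ N ih =>
    subst hs
    by_contra hs0
    obtain ⟨r, y, hyX, hy⟩ := exists_isDesubst hc hq hx
    obtain ⟨t, ht, hyF⟩ := hy.exists_column_intertwining hc hq hbij hyX hy hF h
    obtain rfl : s = q * t := by linarith
    have ht0 : t ≠ 0 := right_ne_zero_of_mul hs0
    have hlt : t.natAbs < (q * t).natAbs := by
      rw [Int.natAbs_mul, Int.natAbs_natCast]
      exact lt_mul_of_one_lt_left (Int.natAbs_pos.2 ht0) hq
    exact ht0 (ih _ hlt hyX (fun n => by simpa [hc] using hyF n 0) rfl)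

theorem mem_equivariantPerm_of_forall_eq_apply_add [Nontrivial A] (hc : c 0 = 1) (hq : 1 < q)
    (hbij : c.Bijective) {x x' : ℤ → A} (hx : x ∈ substSet (columnSubst A c))
    (hx' : x' ∈ substSet (columnSubst A c)) {F : Perm A} {s : ℤ}
    (h : ∀ m, x' m = F (x (m + s))) : F ∈ equivariantPerm K A := by
  obtain ⟨r, y, hyX, hy⟩ := exists_isDesubst hc hq hx
  obtain ⟨r', y', -, hy'⟩ := exists_isDesubst hc hq hx'
  obtain ⟨t, -, hF⟩ := hy.exists_column_intertwining hc hq hbij hyX hy' F.injective h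
  refine mem_equivariantPerm.2 fun k b => ?_
  obtain ⟨i, rfl⟩ := hbij.surjective k
  obtain ⟨n, rfl⟩ := surjective_of_mem_substSet hc hq hbij.surjective hyX b
  have hfirst : y' (n - t) = F (y n) := by simpa [hc] using hF (n - t) 0
  rw [← hfirst, hF, sub_add_cancel]

theorem exists_perm_of_isBlockImage_zero [Finite A] (hc : c 0 = 1) (hq : 1 < q)
    (hsurj : c.Surjective) {x x' : ℤ → A} (hx : x ∈ substSet (columnSubst A c))
    (hx' : x' ∈ substSet (columnSubst A c)) {a : ℤ} (h : IsBlockImage x x' a 0) :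
    ∃ F : Perm A, ∀ m, x' m = F (x (m + a)) := by
  choose p hp using surjective_of_mem_substSet hc hq hsurj hx
  let F (b : A) : A := x' (p b - a)
  have hF (m : ℤ) : x' m = F (x (m + a)) := h _ _ fun j hj => by
    obtain rfl : j = 0 := Nat.le_zero.1 hj
    simp [hp]
  have hF_surj : F.Surjective := fun b => by
    obtain ⟨m, rfl⟩ := surjective_of_mem_substSet hc hq hsurj hx' b
    exact ⟨_, (hF m).symm⟩
  exact ⟨.ofBijective F (Finite.surjective_iff_bijective.1 hF_surj), hF⟩

theorem exists_equivariantPerm_of_isBlockImage [Finite A] [Nontrivial A] (hc : c 0 = 1)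
    (hq : 1 < q) (hbij : c.Bijective) {x x' : ℤ → A} (hx : x ∈ substSet (columnSubst A c))
    (hx' : x' ∈ substSet (columnSubst A c)) {a : ℤ} {w : ℕ} (h : IsBlockImage x x' a w) :
    ∃ F ∈ equivariantPerm K A, ∃ s : ℤ, ∀ m, x' m = F (x (m + s)) := by
  induction w using Nat.strong_induction_on generalizing x x' a with
  | _ w ih =>
    obtain rfl | hw := eq_or_ne w 0
    · obtain ⟨F, hF⟩ := exists_perm_of_isBlockImage_zero hc hq hbij.surjective hx hx' h
      exact ⟨F, mem_equivariantPerm_of_forall_eq_apply_add hc hq hbij hx hx' hF, a, hF⟩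
    obtain ⟨r, y, hyX, hy⟩ := exists_isDesubst hc hq hx
    obtain ⟨r', y', hyX', hy'⟩ := exists_isDesubst hc hq hx'
    obtain ⟨b, hb⟩ := hy.exists_isBlockImage hy' h
    obtain ⟨F, hF, s, hs⟩ := ih _ (Nat.div_lt_self (Nat.pos_of_ne_zero hw) hq) hyX hyX' hb
    refine ⟨F, hF, q * s + r - r', fun m => ?_⟩
    obtain ⟨n, i, hm⟩ := exists_eq_mul_add q (m - r')
    obtain rfl : m = q * n + r' + (i : ℕ) := by linarith
    rw [hy', hs, ← mem_equivariantPerm.1 hF, ← hy]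
    congr 2
    ring

variable [Finite A] [Nontrivial A] [TopologicalSpace A] [DiscreteTopology A]

/-- The homomorphism `(n, F) ↦ σⁿ ∘ F` into the automorphism group of `X_τ`, where the permutation
`F` is applied letter by letter. -/
def columnHom (hc : c 0 = 1) (hq : 1 < q) :
    Multiplicative ℤ × equivariantPerm K A →*
      Aut (shiftHomeo (substSubshift (columnSubst A c))) :=
  shiftLetterHom _ _ fun _ hF _ => comp_mem_substSet hc hq (mem_equivariantPerm.1 hF)

theorem columnHom_injective (hc : c 0 = 1) (hq : 1 < q) (hbij : c.Bijective) :
    Function.Injective (columnHom (A := A) hc hq) := by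
  obtain ⟨x⟩ := (isMinimalSystem_columnSubst (A := A) hc hq hbij.surjective).1
  refine (injective_iff_map_eq_one _).2 fun ⟨n, F⟩ h => ?_
  have hfix : shift n.toAdd (F.1 ∘ x.1) = x.1 :=
    (coe_shiftLetterHom_apply ..).symm.trans (congrArg (fun φ => (φ.1 x : ℤ → A)) h)
  have hx (m : ℤ) : x.1 m = F.1 (x.1 (m + n.toAdd)) := by
    rw [add_comm]
    exact (congrFun hfix m).symm
  obtain rfl : n = 1 := eq_zero_of_forall_eq_apply_add hc hq hbij x.2 F.1.injective hx
  have hF : F = 1 := by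
    ext b
    obtain ⟨m, rfl⟩ := surjective_of_mem_substSet hc hq hbij.surjective x.2 b
    simpa using (hx m).symm
  rw [hF, Prod.mk_one_one]

theorem columnHom_surjective (hc : c 0 = 1) (hq : 1 < q) (hbij : c.Bijective) :
    Function.Surjective (columnHom (A := A) hc hq) := by
  rintro ⟨φ, hφ⟩
  have hmin := isMinimalSystem_columnSubst (A := A) hc hq hbij.surjective
  obtain ⟨x⟩ := hmin.1
  obtain ⟨a, w, hblock⟩ := exists_isBlockImage_of_mem_Aut hφ x
  obtain ⟨F, hF, s, hs⟩ :=
    exists_equivariantPerm_of_isBlockImage hc hq hbij x.2 (φ x).2 hblock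
  refine ⟨(.ofAdd s, ⟨F, hF⟩), Subtype.ext (hmin.eq_of_apply_eq (Subtype.prop _) hφ (x := x) ?_)⟩
  refine Subtype.ext ((coe_shiftLetterHom_apply ..).trans (funext fun m => ?_))
  rw [hs, add_comm]
  rfl

/-- `columnHom` as an isomorphism, when every element of `K` is a column of `τ` exactly once. -/
noncomputable def columnAutEquiv (hc : c 0 = 1) (hq : 1 < q) (hbij : c.Bijective) :
    Multiplicative ℤ × equivariantPerm K A ≃*
      Aut (shiftHomeo (substSubshift (columnSubst A c))) :=
  .ofBijective (columnHom hc hq)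
    ⟨columnHom_injective hc hq hbij, columnHom_surjective hc hq hbij⟩

end Transitive

end ColumnSubst

section Existence

theorem exists_equiv_fin_apply_zero_eq {K : Type*} [Finite K] [Nontrivial K] (k : K) :
    ∃ (q : ℕ) (_ : NeZero q) (c : Fin q ≃ K), 1 < q ∧ c 0 = k := by
  have : NeZero (Nat.card K) := ⟨Nat.card_pos.ne'⟩
  let c := (Finite.equivFin K).symm
  exact ⟨Nat.card K, this, (Equiv.swap 0 (c.symm k)).trans c, Finite.one_lt_card, by simp⟩

theorem exists_subshift_aut_mulEquiv_of_equivariantPerm (K : Type*) (A : Type u) [Group K]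
    [Finite K] [Nontrivial K] [MulAction K A] [MulAction.IsPretransitive K A] [Finite A]
    [Nontrivial A] {G : Type*} [Group G] (ρ : equivariantPerm K A ≃* G) :
    ∃ (B : Type u) (_ : Finite B) (_ : TopologicalSpace B) (_ : DiscreteTopology B)
      (X : Subshift B ℤ), IsSubstitutive X ∧ IsMinimalSystem (shiftHomeo X) ∧
        Nonempty (Aut (shiftHomeo X) ≃* Multiplicative ℤ × G) := by
  let _ : TopologicalSpace A := ⊥
  have : DiscreteTopology A := ⟨rfl⟩
  obtain ⟨q, _, c, hq, hc⟩ := exists_equiv_fin_apply_zero_eq (1 : K)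
  exact ⟨A, inferInstance, inferInstance, inferInstance, substSubshift (columnSubst A c),
    ⟨_, isSubstitution_columnSubst hc hq, rfl⟩, isMinimalSystem_columnSubst hc hq c.surjective,
    ⟨(columnAutEquiv hc hq c.bijective).symm.trans (.prodCongr (.refl _) ρ)⟩⟩

/-- The trivial group cannot act transitively on two letters, so it needs another group on the
alphabet: the symmetric group of three letters, whose centralizer is trivial. -/
theorem exists_subshift_aut_mulEquiv (G : Type u) [Group G] [Finite G] :
    ∃ (A : Type u) (_ : Finite A) (_ : TopologicalSpace A) (_ : DiscreteTopology A)
      (X : Subshift A ℤ), IsSubstitutive X ∧ IsMinimalSystem (shiftHomeo X) ∧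
        Nonempty (Aut (shiftHomeo X) ≃* Multiplicative ℤ × G) := by
  obtain _ | _ := subsingleton_or_nontrivial G
  · let A := ULift.{u} (Fin 3)
    have hA : equivariantPerm (Perm A) A = ⊥ := equivariantPerm_perm_eq_bot (by simp [A])
    have : Unique G := uniqueOfSubsingleton 1
    exact exists_subshift_aut_mulEquiv_of_equivariantPerm (Perm A) A
      ((MulEquiv.subgroupCongr hA).trans .ofUnique)
  · have : Finite Gᵐᵒᵖ := .of_equiv G MulOpposite.opEquiv
    exact exists_subshift_aut_mulEquiv_of_equivariantPerm Gᵐᵒᵖ G (leftMulEquiv G).symm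

end Existence

section GroupSubst

variable {G : Type*} [Group G] {q : ℕ} [NeZero q]

theorem isBijectiveSubst_groupSubst (e : Fin q ≃ G) : IsBijectiveSubst (groupSubst e) q := by
  refine ⟨⟨NeZero.pos q, fun a => List.length_ofFn⟩, fun a b hab i hi h => hab ?_⟩
  simpa [groupSubst, hi] using h

theorem isSubstitution_groupSubst {e : Fin q ≃ G} (he : e 0 = 1) (hq : 1 < q) :
    IsSubstitution (groupSubst e) :=
  isSubstitution_columnSubst (c := MulOpposite.op ∘ e) (congrArg _ he) hq

variable [TopologicalSpace G] [DiscreteTopology G] {e : Fin q ≃ G}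

theorem isMinimalSystem_groupSubst [Finite G] (he : e 0 = 1) (hq : 1 < q) :
    IsMinimalSystem (shiftHomeo (substSubshift (groupSubst e))) :=
  isMinimalSystem_columnSubst (c := MulOpposite.op ∘ e) (congrArg _ he) hq
    (MulOpposite.op_surjective.comp e.surjective)

/-- The isomorphism `(n, g) ↦ σⁿ ∘ L_g`. The letter `g` is read as a point of the right regular
action, in which `τ` has the columns `g₀, …, g_{q-1}`, so that left translations are the
equivariant permutations. -/
noncomputable def groupAutEquiv [Finite G] [Nontrivial G] (he : e 0 = 1) (hq : 1 < q) :
    Multiplicative ℤ × G ≃* Aut (shiftHomeo (substSubshift (groupSubst e))) :=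
  (MulEquiv.prodCongr (.refl _) (leftMulEquiv G)).trans <|
    columnAutEquiv (c := MulOpposite.op ∘ e) (congrArg _ he) hq
      (MulOpposite.op_bijective.comp e.bijective)

theorem coe_groupAutEquiv_apply [Finite G] [Nontrivial G] (he : e 0 = 1) (hq : 1 < q) (n : ℤ)
    (g : G) (x : (substSubshift (groupSubst e)).carrier) :
    ((groupAutEquiv he hq (.ofAdd n, g)).1 x : ℤ → G) = shift n (leftTranslate g x) :=
  coe_shiftLetterHom_apply ..

end GroupSubst

end SubstDyn

/-- First part: every finite group `G` is realized as `Aut(X, σ) ≅ ℤ ⊕ G` by a minimal substitutive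
subshift over a finite (discrete) alphabet. Second part: if `G` is nontrivial, then for every
enumeration `g₀ = 1, g₁, …, g_{q-1}` of `G` the subshift of `g ↦ (g g₀)⋯(g g_{q-1})` is such an
example, and `(n, g) ↦ σⁿ ∘ L_g` is an isomorphism `ℤ ⊕ G ≅ Aut(X_τ, σ)`. -/
theorem theorem3p6 (G : Type u) [Group G] [Finite G] :
    (∃ (A : Type u) (_ : Finite A) (_ : TopologicalSpace A) (_ : DiscreteTopology A)
        (X : Subshift A ℤ),
      SubstDyn.IsSubstitutive X ∧
      SubstDyn.IsMinimalSystem (SubstDyn.shiftHomeo X) ∧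
      Nonempty (SubstDyn.Aut (SubstDyn.shiftHomeo X) ≃* Multiplicative ℤ × G)) ∧
    (∀ [Nontrivial G] [TopologicalSpace G] [DiscreteTopology G] (q : ℕ) [NeZero q]
        (e : Fin q ≃ G), e 0 = 1 →
      SubstDyn.IsSubstitution (SubstDyn.groupSubst e) ∧
      SubstDyn.IsBijectiveSubst (SubstDyn.groupSubst e) q ∧
      SubstDyn.IsMinimalSystem
        (SubstDyn.shiftHomeo (SubstDyn.substSubshift (SubstDyn.groupSubst e))) ∧
      (∃ Φ : Multiplicative ℤ × G ≃*
          SubstDyn.Aut (SubstDyn.shiftHomeo (SubstDyn.substSubshift (SubstDyn.groupSubst e))),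
        ∀ (n : ℤ) (g : G) (x : (SubstDyn.substSubshift (SubstDyn.groupSubst e)).carrier),
          ((Φ (Multiplicative.ofAdd n, g)).1 x : ℤ → G) =
            shift n (SubstDyn.leftTranslate g x)) ∧
      (∀ φ ∈ SubstDyn.Aut (SubstDyn.shiftHomeo (SubstDyn.substSubshift (SubstDyn.groupSubst e))),
        ∃ (n : ℤ) (g : G),
          ∀ x : (SubstDyn.substSubshift (SubstDyn.groupSubst e)).carrier,
            (φ x : ℤ → G) = shift n (SubstDyn.leftTranslate g x))) := by
  refine ⟨SubstDyn.exists_subshift_aut_mulEquiv G, ?_⟩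
  intro _ _ _ q _ e he
  have hq : 1 < q := Fin.nontrivial_iff_two_le.1 e.nontrivial
  let Φ := SubstDyn.groupAutEquiv he hq
  have hΦ := SubstDyn.coe_groupAutEquiv_apply he hq
  refine ⟨SubstDyn.isSubstitution_groupSubst he hq, SubstDyn.isBijectiveSubst_groupSubst e,
    SubstDyn.isMinimalSystem_groupSubst he hq, ⟨Φ, hΦ⟩, fun φ hφ => ?_⟩
  obtain ⟨⟨n, g⟩, hng⟩ := Φ.surjective ⟨φ, hφ⟩
  obtain rfl : (Φ (n, g)).1 = φ := congrArg Subtype.val hng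
  exact ⟨n.toAdd, g, hΦ n.toAdd g⟩
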